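/- Let $\mu\in\mathbb R$, $\sigma>0$, and let $\pi=\gamma/\mathcal Z$ be the density of $\mathcal N(\mu,\sigma^2)$ on $\mathbb R$, where $\mathcal Z>0$ is a constant. Let $\beta:[0,\infty)\to(0,\infty)$ be a locally integrable function with $\lim_{T\to\infty}\int_0^T\beta_s\,\mathrm ds=\infty$, and put $\lambda_t=1-\exp\bigl(-2\int_0^t\beta_s\,\mathrm ds\bigr)$. Let $p_0$ be the density of $\mathcal N(0,1)$, $g_0=\gamma/p_0$, and $\hat g_t(x)=g_0(\sqrt{1-\lambda_t}\,x)$ (the naive guidance). For each $T>0$ let $(Z^{(T)}_t)_{t\in[0,T]}$ be a continuous adapted solution, on some filtered probability space with Brownian motion $B$, of $$\mathrm dZ^{(T)}_t=\bigl[-\beta_{T-t}Z^{(T)}_t+2\beta_{T-t}\,\nabla\log\hat g_{T-t}(Z^{(T)}_t)\bigr]\mathrm dt+\sqrt{2\beta_{T-t}}\,\mathrm dB_t,\qquad Z^{(T)}_0\sim\mathcal N(0,1).$$ Then $Z^{(T)}_T$ has a finite second moment for every $T>0$, and the following hold. (i) If $\sigma=1$, then $\lim_{T\to\infty}\mathbb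 E[Z^{(T)}_T]=\mu$ and $\lim_{T\to\infty}\operatorname{Var}(Z^{(T)}_T)=1$. (ii) If $\sigma\neq1$, then $$\lim_{T\to\infty}\mathbb E[Z^{(T)}_T]=\frac{\mu}{1-\sigma^2}\Bigl(1-e^{-(1/\sigma^2-1)}\Bigr),\qquad \lim_{T\to\infty}\operatorname{Var}(Z^{(T)}_T)=\frac{1-e^{-2(1/\sigma^2-1)}}{2(1/\sigma^2-1)}.$$ In particular, if $\sigma\ne1$, then $\lim_{T\to\infty}\operatorname{Var}(Z^{(T)}_T)\neq\sigma^2$, and if moreover $\mu\neq0$, then $\lim_{T\to\infty}\mathbb E[Z^{(T)}_T]\neq\mu$. So for $\sigma\ne 1$ the naive guidance is biased even without time discretization. -/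

import Mathlib

open MeasureTheory ProbabilityTheory Filter
open scoped NNReal ENNReal Topology

noncomputable section

namespace NaiveGuidance

/-! ### The noise schedule and the naive guidance -/

/-- `λ_t = 1 - exp (-2 ∫₀ᵗ β_s ds)`. -/
def lam (β : ℝ → ℝ) (t : ℝ) : ℝ :=
  1 - Real.exp (-2 * ∫ s in (0 : ℝ)..t, β s)

/-- The potential `g₀ = γ / p₀`, where `γ` is an unnormalised target density and `p₀` is the
density of the standard normal distribution. -/
def g0 (γ : ℝ → ℝ) (x : ℝ) : ℝ :=
  γ x / gaussianPDFReal 0 1 x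

/-- The naive guidance `ĝ_t(x) = g₀(√(1 - λ_t) x)`. -/
def gHat (β γ : ℝ → ℝ) (t x : ℝ) : ℝ :=
  g0 γ (Real.sqrt (1 - lam β t) * x)

/-- The drift `-β_{T-t} x + 2 β_{T-t} ∇ log ĝ_{T-t}(x)` of the guided reverse diffusion. -/
def drift (β γ : ℝ → ℝ) (T t x : ℝ) : ℝ :=
  -β (T - t) * x + 2 * β (T - t) * deriv (fun y => Real.log (gHat β γ (T - t) y)) x

/-- The diffusion coefficient `√(2 β_{T-t})` of the reverse diffusion. -/
def diffusionCoeff (β : ℝ → ℝ) (T t : ℝ) : ℝ :=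
  Real.sqrt (2 * β (T - t))

/-! ### Stochastic integrals of deterministic functions -/

/-- The data of a step function `∑_{i < n} coef i • 1_{(time i, time (i+1)]}` on `[0, ∞)`. -/
structure StepData where
  n : ℕ
  time : ℕ → ℝ≥0
  mono : Monotone time
  coef : ℕ → ℝ

/-- The step function itself. -/
def StepData.toFun (φ : StepData) (u : ℝ) : ℝ :=
  ∑ i ∈ Finset.range φ.n,
    Set.indicator (Set.Ioc (φ.time i : ℝ) (φ.time (i + 1) : ℝ)) (fun _ => φ.coef i) u

/-- The elementary integral `∫₀ᵗ φ dB = ∑_{i < n} coef i * (B_{time (i+1) ∧ t} - B_{time i ∧ t})`. -/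
def StepData.integral {Ω : Type*} (φ : StepData) (B : ℝ≥0 → Ω → ℝ) (t : ℝ≥0) (ω : Ω) : ℝ :=
  ∑ i ∈ Finset.range φ.n,
    φ.coef i * (B (min (φ.time (i + 1)) t) ω - B (min (φ.time i) t) ω)

/-- `I` is (a version of) the stochastic integral `∫₀ᵗ f dB` of the deterministic function
`f ∈ L²(0, t)`: the `L²(P)`-limit of the elementary integrals of a sequence of step functions that
converges to `f` in `L²(0, t)`. -/
def IsStochasticIntegral {Ω : Type*} [MeasurableSpace Ω] (B : ℝ≥0 → Ω → ℝ) (P : Measure Ω)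
    (f : ℝ → ℝ) (t : ℝ≥0) (I : Ω → ℝ) : Prop :=
  ∃ φ : ℕ → StepData,
    Tendsto (fun k => eLpNorm (fun u => (φ k).toFun u - f u) 2
      (volume.restrict (Set.Ioc (0 : ℝ) (t : ℝ)))) atTop (𝓝 0) ∧
    Tendsto (fun k => eLpNorm (fun ω => (φ k).integral B t ω - I ω) 2 P) atTop (𝓝 0)

/-! ### Solutions of stochastic differential equations with additive noise -/

/-- `B` is a Brownian motion relative to the filtration `𝓕`. -/
structure IsFilteredBrownian {Ω : Type*} {mΩ : MeasurableSpace Ω} (𝓕 : Filtration ℝ≥0 mΩ)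
    (B : ℝ≥0 → Ω → ℝ) (P : Measure Ω) : Prop where
  isBrownian : IsBrownianReal B P
  adapted : ∀ t, Measurable[𝓕 t] (B t)
  indep : ∀ s t, s ≤ t →
    Indep (MeasurableSpace.comap (fun ω => B t ω - B s ω) inferInstance) (𝓕 s) P

/-- `Z` is a solution on `[0, T]`, with driving Brownian motion `B` and filtration `𝓕`, of
`dZ_t = b(t, Z_t) dt + s(t) dB_t`. Only the values of `Z` at times in `[0, T]` matter. -/
structure IsSDESolution {Ω : Type*} {mΩ : MeasurableSpace Ω} (b : ℝ → ℝ → ℝ) (s : ℝ → ℝ)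
    (T : ℝ≥0) (𝓕 : Filtration ℝ≥0 mΩ) (B : ℝ≥0 → Ω → ℝ) (P : Measure Ω)
    (Z : ℝ≥0 → Ω → ℝ) : Prop where
  brownian : IsFilteredBrownian 𝓕 B P
  adapted : ∀ t ≤ T, Measurable[𝓕 t] (Z t)
  continuous : ∀ᵐ ω ∂P, ContinuousOn (fun t => Z t ω) (Set.Icc 0 T)
  drift_integrable : ∀ᵐ ω ∂P,
    IntervalIntegrable (fun u : ℝ => b u (Z u.toNNReal ω)) volume 0 (T : ℝ)
  equation : ∀ t ≤ T, ∃ I : Ω → ℝ, IsStochasticIntegral B P s t I ∧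
    ∀ᵐ ω ∂P, Z t ω = Z 0 ω + (∫ u in (0 : ℝ)..(t : ℝ), b u (Z u.toNNReal ω)) + I ω

end NaiveGuidance

end

/-!
For a Gaussian target the guided drift is affine in space, so `Z` solves a linear equation
`dZ = (A Z + C) dt + s dB` with `A = -β (1 + 2 k a²)`, `C = 2 β a μ / σ²`, `s² = 2 β`, where
`k = 1 / σ² - 1`, `a u = exp (-∫₀^{T-u} β)` and `β` is evaluated at `T - u` (`drift_eq`). The
propagator is `Φ u = exp (∫ᵤᵀ A) = a u * exp (-k (1 - a u ²))`, and variation of constants gives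
`Z_T = Φ 0 Z_0 + ∫ Φ C du + ∫ Φ s dB`. Hence the mean is `∫ Φ C` and the variance is
`Φ 0 ² + ∫ Φ² s²`; since `(a²)' = 2 β a²`, both integrands have explicit primitives
(`guided_moments`), and `a 0 = exp (-∫₀ᵀ β) → 0` gives the limits.

The stochastic integral of a deterministic function is only given separately at each time, up to
null sets, and `β` is only integrable. The noise is therefore recovered pathwise from the equation
as `F u = Z_u - Z_0 - ∫₀ᵘ (A Z + C)`, which is continuous in time, and `∫ Φ s dB` is replaced by
its integrated-by-parts form `W = F T + ∫ Φ A F du`. This makes the solution formula an identity of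
absolutely continuous functions for every path (`variation_of_constants`). At each time `F u` is a
version of the stochastic integral, so that the Itô isometry
(`IsStochasticIntegral.integral_mul`) gives `E[F u F v] = ∫₀^{min u v} s²`. Fubini's theorem
(`integral_mul_integral_mul`) then turns `E W²` into deterministic integrals, which integration by
parts reduces to `∫ Φ² s²` (`moments_weighted_noise`). Together these give
`IsSDESolution.linear_moments`.

That the limits are not the target moments follows from `exp x > 1 + x` for `x ≠ 0`: directly for
the mean (`exp_neg_ne`), and through Rolle's theorem for the variance (`one_add_mul_exp_ne`).
-/

namespace NaiveGuidance

/-! ### Calculus of absolutely continuous functions -/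

/-- `F` is absolutely continuous between `a` and `b`, with almost everywhere derivative `f`. -/
structure HasACDeriv (F f : ℝ → ℝ) (a b : ℝ) : Prop where
  ac : AbsolutelyContinuousOnInterval F a b
  deriv : ∀ᵐ x, x ∈ Set.uIcc a b → HasDerivAt F (f x) x

namespace HasACDeriv

variable {F G f g : ℝ → ℝ} {a b : ℝ}

lemma integral_eq_sub (h : HasACDeriv F f a b) : ∫ x in a..b, f x = F b - F a := by
  rw [← h.ac.integral_deriv_eq_sub]
  refine intervalIntegral.integral_congr_ae ?_
  filter_upwards [h.deriv] with x hx hxm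
  exact (hx (Set.uIoc_subset_uIcc hxm)).deriv.symm

lemma intervalIntegrable (h : HasACDeriv F f a b) : IntervalIntegrable f volume a b := by
  refine h.ac.intervalIntegrable_deriv.congr_ae ?_
  refine (ae_restrict_iff' measurableSet_uIoc).2 ?_
  filter_upwards [h.deriv] with x hx hxm
  exact (hx (Set.uIoc_subset_uIcc hxm)).deriv

lemma continuousOn (h : HasACDeriv F f a b) : ContinuousOn F (Set.uIcc a b) := h.ac.continuousOn

lemma mono {c d : ℝ} (h : HasACDeriv F f a b) (hcd : Set.uIcc c d ⊆ Set.uIcc a b) :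
    HasACDeriv F f c d where
  ac := h.ac.mono hcd
  deriv := by
    filter_upwards [h.deriv] with x hx hxm using hx (hcd hxm)

lemma congr_deriv (h : HasACDeriv F f a b) (hfg : ∀ᵐ x, x ∈ Set.uIoc a b → f x = g x) :
    HasACDeriv F g a b where
  ac := h.ac
  deriv := by
    have h₁ : ∀ᵐ x : ℝ, x ≠ a := by simp [ae_iff, measure_singleton]
    have h₂ : ∀ᵐ x : ℝ, x ≠ b := by simp [ae_iff, measure_singleton]
    filter_upwards [h.deriv, hfg, h₁, h₂] with x hx hx' ha hb hxm
    rw [← hx']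
    · exact hx hxm
    · rcases Set.mem_uIcc.1 hxm with ⟨h1, h2⟩ | ⟨h1, h2⟩
      · exact Set.mem_uIoc.2 (Or.inl ⟨lt_of_le_of_ne h1 ha.symm, h2⟩)
      · exact Set.mem_uIoc.2 (Or.inr ⟨lt_of_le_of_ne h1 hb.symm, h2⟩)

lemma mul (hF : HasACDeriv F f a b) (hG : HasACDeriv G g a b) :
    HasACDeriv (fun x => F x * G x) (fun x => f x * G x + F x * g x) a b where
  ac := hF.ac.fun_mul hG.ac
  deriv := by
    filter_upwards [hF.deriv, hG.deriv] with x hx hx' hxm using (hx hxm).mul (hx' hxm)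

lemma const_mul (c : ℝ) (hF : HasACDeriv F f a b) :
    HasACDeriv (fun x => c * F x) (fun x => c * f x) a b where
  ac := hF.ac.const_mul c
  deriv := by
    filter_upwards [hF.deriv] with x hx hxm using (hx hxm).const_mul c

lemma const_add (c : ℝ) (hF : HasACDeriv F f a b) :
    HasACDeriv (fun x => c + F x) f a b where
  ac := by
    have : AbsolutelyContinuousOnInterval (fun _ : ℝ => c) a b :=
      (LipschitzWith.const c).lipschitzOnWith.absolutelyContinuousOnInterval
    exact this.add hF.ac
  deriv := by
    filter_upwards [hF.deriv] with x hx hxm using (hx hxm).const_add c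

/-- The exponential is Lipschitz on the (bounded) range of `F`, so `exp ∘ F` is again absolutely
continuous. -/
lemma exp (hF : HasACDeriv F f a b) :
    HasACDeriv (fun x => Real.exp (F x)) (fun x => Real.exp (F x) * f x) a b where
  ac := by
    obtain ⟨M, hM⟩ := hF.ac.exists_bound
    have hlip : ∀ x ∈ Set.uIcc a b, ∀ y ∈ Set.uIcc a b,
        dist (Real.exp (F x)) (Real.exp (F y)) ≤ Real.exp M * dist (F x) (F y) := by
      intro x hx y hy
      have := (convex_Icc (-M) M).norm_image_sub_le_of_norm_deriv_le
        (f := Real.exp) (C := Real.exp M) (x := F y) (y := F x)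
        (fun z _ => Real.differentiableAt_exp) (fun z hz => by
          rw [Real.deriv_exp, Real.norm_eq_abs, abs_of_pos (Real.exp_pos _)]
          exact Real.exp_le_exp.2 hz.2) (abs_le.1 (hM y hy)) (abs_le.1 (hM x hx))
      simpa [dist_eq_norm] using this
    rw [absolutelyContinuousOnInterval_iff]
    intro ε hε
    obtain ⟨δ, hδ, h⟩ := (absolutelyContinuousOnInterval_iff _ _ _).1 hF.ac
      (ε / Real.exp M) (div_pos hε (Real.exp_pos _))
    refine ⟨δ, hδ, fun E hE hE' => ?_⟩
    have := h E hE hE'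
    rw [lt_div_iff₀' (Real.exp_pos _), Finset.mul_sum] at this
    refine lt_of_le_of_lt (Finset.sum_le_sum fun i hi => ?_) this
    exact hlip _ (hE.1 i hi).1 _ (hE.1 i hi).2
  deriv := by
    filter_upwards [hF.deriv] with x hx hxm using (hx hxm).exp

end HasACDeriv

lemma hasACDeriv_integral {f : ℝ → ℝ} {a b : ℝ} (h : IntervalIntegrable f volume a b) :
    HasACDeriv (fun x => ∫ v in a..x, f v) f a b where
  ac := h.absolutelyContinuousOnInterval_intervalIntegral Set.left_mem_uIcc
  deriv := by
    filter_upwards [h.ae_hasDerivAt_integral] with x hx hxm using hx hxm _ Set.left_mem_uIcc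

/-! ### Limits in `L²` -/

lemma tendsto_integral_mul {α : Type*} [MeasurableSpace α] {m : Measure α}
    {X Y : ℕ → α → ℝ} {x y : α → ℝ} (hX : ∀ k, MemLp (X k) 2 m) (hY : ∀ k, MemLp (Y k) 2 m)
    (hx : MemLp x 2 m) (hy : MemLp y 2 m)
    (hXx : Tendsto (fun k => eLpNorm (fun a => X k a - x a) 2 m) atTop (𝓝 0))
    (hYy : Tendsto (fun k => eLpNorm (fun a => Y k a - y a) 2 m) atTop (𝓝 0)) :
    Tendsto (fun k => ∫ a, X k a * Y k a ∂m) atTop (𝓝 (∫ a, x a * y a ∂m)) := by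
  have key : ∀ {u v : α → ℝ} (hu : MemLp u 2 m) (hv : MemLp v 2 m),
      ∫ a, u a * v a ∂m = inner ℝ (hu.toLp u) (hv.toLp v) := by
    intro u v hu hv
    rw [L2.inner_def]
    refine integral_congr_ae ?_
    filter_upwards [hu.coeFn_toLp, hv.coeFn_toLp] with a ha hb
    rw [ha, hb]
    simp [mul_comm]
  simp_rw [fun k => key (hX k) (hY k), key hx hy]
  exact Tendsto.inner ((Lp.tendsto_Lp_iff_tendsto_eLpNorm'' X hX x hx).2 hXx)
    ((Lp.tendsto_Lp_iff_tendsto_eLpNorm'' Y hY y hy).2 hYy)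

lemma memLp_of_tendsto_eLpNorm_sub {α : Type*} [MeasurableSpace α] {m : Measure α}
    {X : ℕ → α → ℝ} {x : α → ℝ} (hX : ∀ k, MemLp (X k) 2 m) (hx : AEStronglyMeasurable x m)
    (hXx : Tendsto (fun k => eLpNorm (fun a => X k a - x a) 2 m) atTop (𝓝 0)) :
    MemLp x 2 m := by
  obtain ⟨k, hk⟩ := (hXx.eventually (gt_mem_nhds ENNReal.zero_lt_top)).exists
  have h : MemLp (fun a => X k a - x a) 2 m := ⟨(hX k).1.sub hx, hk⟩
  have e : x = X k - fun a => X k a - x a := by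
    ext a
    simp
  rw [e]
  exact (hX k).sub h

/-! ### The isometry for stochastic integrals of deterministic functions -/

section Isometry

variable {Ω : Type*} {mΩ : MeasurableSpace Ω} {B : ℝ≥0 → Ω → ℝ} {P : Measure Ω}

lemma memLp_brownian (hB : IsPreBrownianReal B P) (t : ℝ≥0) : MemLp (B t) 2 P :=
  (hB.isGaussianProcess.hasGaussianLaw_eval t).memLp_two

lemma integral_brownian_mul [IsProbabilityMeasure P] (hB : IsPreBrownianReal B P) (s t : ℝ≥0) :
    ∫ ω, B s ω * B t ω ∂P = min (s : ℝ) t := by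
  have h := hB.covariance_eval s t
  rw [covariance_eq_sub (memLp_brownian hB s) (memLp_brownian hB t), hB.integral_eval] at h
  simpa using h

lemma integral_increment_mul [IsProbabilityMeasure P] (hB : IsPreBrownianReal B P)
    {a b c d : ℝ≥0} (hab : a ≤ b) (hcd : c ≤ d) :
    ∫ ω, (B b ω - B a ω) * (B d ω - B c ω) ∂P =
      volume.real (Set.Ioc (a : ℝ) b ∩ Set.Ioc (c : ℝ) d) := by
  have hi : ∀ s t : ℝ≥0, Integrable (fun ω => B s ω * B t ω) P := fun s t =>
    (memLp_brownian hB s).integrable_mul (memLp_brownian hB t)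
  have hs : ∀ s t r q : ℝ≥0, Integrable (fun ω => B s ω * B t ω - B r ω * B q ω) P :=
    fun _ _ _ _ => (hi _ _).sub (hi _ _)
  have e : ∀ ω, (B b ω - B a ω) * (B d ω - B c ω) =
      (B b ω * B d ω - B a ω * B d ω) - (B b ω * B c ω - B a ω * B c ω) := fun ω => by ring
  simp_rw [e]
  rw [integral_sub (hs _ _ _ _) (hs _ _ _ _),
    integral_sub (hi _ _) (hi _ _), integral_sub (hi _ _) (hi _ _)]
  simp_rw [integral_brownian_mul hB]
  rw [Set.Ioc_inter_Ioc, Real.volume_real_Ioc]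
  have hab' : (a : ℝ) ≤ b := hab
  have hcd' : (c : ℝ) ≤ d := hcd
  grind

lemma StepData.memLp_integral (hB : IsPreBrownianReal B P) (φ : StepData) (t : ℝ≥0) :
    MemLp (φ.integral B t) 2 P :=
  memLp_finsetSum _ fun _ _ =>
    ((memLp_brownian hB _).sub (memLp_brownian hB _)).const_mul _

lemma StepData.memLp_toFun (φ : StepData) (m : Measure ℝ) [IsFiniteMeasure m] :
    MemLp φ.toFun 2 m := by
  refine memLp_finsetSum _ fun i _ => ?_
  exact (memLp_const _).indicator measurableSet_Ioc

/-- Both sides are bilinear, and on single increments they reduce to the covariance `min s t` of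
Brownian motion. -/
lemma StepData.integral_mul_integral [IsProbabilityMeasure P] (hB : IsPreBrownianReal B P)
    (φ ψ : StepData) (s t : ℝ≥0) :
    ∫ ω, φ.integral B s ω * ψ.integral B t ω ∂P =
      ∫ u in Set.Ioc (0 : ℝ) (min s t : ℝ≥0), φ.toFun u * ψ.toFun u := by
  simp only [StepData.integral, StepData.toFun, Finset.sum_mul_sum]
  have h1 : ∀ i j, Integrable (fun ω =>
      φ.coef i * (B (min (φ.time (i + 1)) s) ω - B (min (φ.time i) s) ω) *
        (ψ.coef j * (B (min (ψ.time (j + 1)) t) ω - B (min (ψ.time j) t) ω))) P := fun i j =>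
    (((memLp_brownian hB _).sub (memLp_brownian hB _)).const_mul (φ.coef i)).integrable_mul
      (((memLp_brownian hB _).sub (memLp_brownian hB _)).const_mul (ψ.coef j))
  have h2 : ∀ i j, Integrable (fun u =>
      Set.indicator (Set.Ioc (φ.time i : ℝ) (φ.time (i + 1))) (fun _ => φ.coef i) u *
        Set.indicator (Set.Ioc (ψ.time j : ℝ) (ψ.time (j + 1))) (fun _ => ψ.coef j) u)
      (volume.restrict (Set.Ioc (0 : ℝ) (min s t : ℝ≥0))) := fun i j =>
    ((memLp_const (φ.coef i)).indicator measurableSet_Ioc).integrable_mul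
      (q := 2) (p := 2) ((memLp_const (ψ.coef j)).indicator measurableSet_Ioc)
  rw [integral_finsetSum _ fun i _ => integrable_finsetSum _ fun j _ => h1 i j,
    integral_finsetSum _ fun i _ => integrable_finsetSum _ fun j _ => h2 i j]
  refine Finset.sum_congr rfl fun i _ => ?_
  rw [integral_finsetSum _ fun j _ => h1 i j, integral_finsetSum _ fun j _ => h2 i j]
  refine Finset.sum_congr rfl fun j _ => ?_
  simp_rw [fun ω => mul_mul_mul_comm (φ.coef i)
    (B (min (φ.time (i + 1)) s) ω - B (min (φ.time i) s) ω) (ψ.coef j)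
    (B (min (ψ.time (j + 1)) t) ω - B (min (ψ.time j) t) ω), integral_const_mul]
  rw [integral_increment_mul hB (min_le_min_right _ (φ.mono i.le_succ))
    (min_le_min_right _ (ψ.mono j.le_succ))]
  have e : ∀ u, Set.indicator (Set.Ioc (φ.time i : ℝ) (φ.time (i + 1))) (fun _ => φ.coef i) u *
      Set.indicator (Set.Ioc (ψ.time j : ℝ) (ψ.time (j + 1))) (fun _ => ψ.coef j) u =
      Set.indicator (Set.Ioc (φ.time i : ℝ) (φ.time (i + 1)) ∩
        Set.Ioc (ψ.time j : ℝ) (ψ.time (j + 1))) (fun _ => φ.coef i * ψ.coef j) u := by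
    intro u
    rw [Set.inter_indicator_mul]
  simp_rw [e]
  rw [setIntegral_indicator (measurableSet_Ioc.inter measurableSet_Ioc), setIntegral_const,
    smul_eq_mul, mul_comm]
  congr 2
  ext u
  simp only [NNReal.coe_min, Set.mem_inter_iff, Set.mem_Ioc]
  have h0 := (φ.time i).coe_nonneg
  have h1 := (ψ.time j).coe_nonneg
  grind

lemma StepData.integral_mul_eq_zero (hB : IsPreBrownianReal B P) (φ : StepData) (t : ℝ≥0)
    {Y : Ω → ℝ} (hY : MemLp Y 2 P) (hYB : ∀ p, ∫ ω, Y ω * B p ω ∂P = 0) :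
    ∫ ω, Y ω * φ.integral B t ω ∂P = 0 := by
  have hi : ∀ p, Integrable (fun ω => Y ω * B p ω) P := fun p =>
    hY.integrable_mul (memLp_brownian hB p)
  simp only [StepData.integral, Finset.mul_sum, mul_left_comm (Y _), mul_sub]
  rw [integral_finsetSum _ fun i _ => ?_]
  · refine Finset.sum_eq_zero fun i _ => ?_
    rw [integral_sub ((hi _).const_mul _) ((hi _).const_mul _), integral_const_mul,
      integral_const_mul, hYB, hYB]
    simp
  · exact ((hi _).const_mul _).sub ((hi _).const_mul _)

variable {f : ℝ → ℝ} {I J : Ω → ℝ} {s t : ℝ≥0}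

/-- Measurability has to be assumed: an `L²`-limit in the sense of `eLpNorm` need not be
measurable. -/
lemma IsStochasticIntegral.memLp (hB : IsPreBrownianReal B P)
    (hI : IsStochasticIntegral B P f t I) (hIm : AEStronglyMeasurable I P) : MemLp I 2 P := by
  obtain ⟨φ, -, h⟩ := hI
  exact memLp_of_tendsto_eLpNorm_sub (fun k => (φ k).memLp_integral hB t) hIm h

lemma IsStochasticIntegral.congr_ae (hI : IsStochasticIntegral B P f t I) (h : I =ᵐ[P] J) :
    IsStochasticIntegral B P f t J := by
  obtain ⟨φ, h1, h2⟩ := hI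
  refine ⟨φ, h1, h2.congr fun k => eLpNorm_congr_ae ?_⟩
  filter_upwards [h] with ω hω
  rw [hω]

/-- The Itô isometry, in polarised form and at two times. -/
lemma IsStochasticIntegral.integral_mul [IsProbabilityMeasure P] (hB : IsPreBrownianReal B P)
    (hI : IsStochasticIntegral B P f s I) (hJ : IsStochasticIntegral B P f t J)
    (hIm : AEStronglyMeasurable I P) (hJm : AEStronglyMeasurable J P)
    (hf : MemLp f 2 (volume.restrict (Set.Ioc (0 : ℝ) (min s t : ℝ≥0)))) :
    ∫ ω, I ω * J ω ∂P = ∫ u in Set.Ioc (0 : ℝ) (min s t : ℝ≥0), f u ^ 2 := by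
  have hI2 := hI.memLp hB hIm
  have hJ2 := hJ.memLp hB hJm
  obtain ⟨φ, h1, h2⟩ := hI
  obtain ⟨ψ, h3, h4⟩ := hJ
  have hL := tendsto_integral_mul (fun k => (φ k).memLp_integral hB s)
    (fun k => (ψ k).memLp_integral hB t) hI2 hJ2 h2 h4
  simp_rw [fun k => StepData.integral_mul_integral hB (φ k) (ψ k) s t] at hL
  have hle : ∀ r : ℝ≥0, min s t ≤ r → volume.restrict (Set.Ioc (0 : ℝ) (min s t : ℝ≥0)) ≤
      volume.restrict (Set.Ioc (0 : ℝ) r) := fun r hr =>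
    Measure.restrict_mono (Set.Ioc_subset_Ioc_right (NNReal.coe_le_coe.2 hr)) le_rfl
  have hR := tendsto_integral_mul (X := fun k => (φ k).toFun) (Y := fun k => (ψ k).toFun)
    (m := volume.restrict (Set.Ioc (0 : ℝ) (min s t : ℝ≥0)))
    (fun k => (φ k).memLp_toFun _) (fun k => (ψ k).memLp_toFun _) hf hf
    (tendsto_of_tendsto_of_tendsto_of_le_of_le tendsto_const_nhds h1 (fun _ => zero_le)
      (fun k => eLpNorm_mono_measure _ (hle s (min_le_left _ _))))
    (tendsto_of_tendsto_of_tendsto_of_le_of_le tendsto_const_nhds h3 (fun _ => zero_le)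
      (fun k => eLpNorm_mono_measure _ (hle t (min_le_right _ _))))
  simpa [sq] using tendsto_nhds_unique hL hR

lemma IsStochasticIntegral.integral_mul_eq_zero (hB : IsPreBrownianReal B P)
    (hI : IsStochasticIntegral B P f t I) (hIm : AEStronglyMeasurable I P)
    {Y : Ω → ℝ} (hY : MemLp Y 2 P) (hYB : ∀ p, ∫ ω, Y ω * B p ω ∂P = 0) :
    ∫ ω, Y ω * I ω ∂P = 0 := by
  have hI2 := hI.memLp hB hIm
  obtain ⟨φ, -, h2⟩ := hI
  have hL := tendsto_integral_mul (fun _ => hY) (fun k => (φ k).memLp_integral hB t) hY hI2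
    (by simp) h2
  simp_rw [fun k => (φ k).integral_mul_eq_zero hB t hY hYB] at hL
  exact (tendsto_nhds_unique hL tendsto_const_nhds)

/-- A square integrable variable known at time `0` is uncorrelated with the Brownian motion. -/
lemma IsFilteredBrownian.integral_mul_eq_zero [IsProbabilityMeasure P]
    {𝓕 : Filtration ℝ≥0 mΩ} (hB : IsFilteredBrownian 𝓕 B P) {Y : Ω → ℝ}
    (hY : Measurable[𝓕 0] Y) (p : ℝ≥0) : ∫ ω, Y ω * B p ω ∂P = 0 := by
  have hpre := hB.isBrownian.toIsPreBrownianReal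
  have hind : IndepFun Y (fun ω => B p ω - B 0 ω) P :=
    (indep_of_indep_of_le_right (hB.indep 0 p (zero_le)) hY.comap_le).symm
  have e : ∫ ω, Y ω * B p ω ∂P = ∫ ω, Y ω * (B p ω - B 0 ω) ∂P := by
    refine integral_congr_ae ?_
    filter_upwards [hpre.eval_zero_ae_eq_zero] with ω hω
    rw [hω, sub_zero]
  rw [e, hind.integral_fun_mul_eq_mul_integral (hY.mono (𝓕.le 0) le_rfl).aestronglyMeasurable
    ((memLp_brownian hpre p).sub (memLp_brownian hpre 0)).1,
    integral_sub (hpre.integrable_eval _) (hpre.integrable_eval _), hpre.integral_eval,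
    hpre.integral_eval]
  simp

end Isometry

/-! ### Time integrals of square integrable processes -/

section TimeIntegral

variable {E Ω : Type*} [MeasurableSpace E] {mΩ : MeasurableSpace Ω} {P : Measure Ω}
  {m : Measure E} {ρ : E → ℝ} {F : E → Ω → ℝ} {K : ℝ}

/-- A real-valued case of the Cauchy–Schwarz inequality with weight `|ρ|`. -/
lemma sq_integral_mul_le {f : E → ℝ} (hρ : Integrable ρ m)
    (hf : Integrable (fun u => ρ u * f u) m) (hf2 : Integrable (fun u => ρ u * f u ^ 2) m) :
    (∫ u, ρ u * f u ∂m) ^ 2 ≤ (∫ u, |ρ u| ∂m) * ∫ u, |ρ u * f u ^ 2| ∂m := by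
  have h1 : Integrable (fun u => |ρ u| * |f u|) m := by simpa [abs_mul] using hf.abs
  have h2 : Integrable (fun u => |ρ u| * |f u| ^ 2) m := by simpa [abs_mul] using hf2.abs
  -- The quadratic `∫ |ρ| (|f| - c)²` in `c` is nonnegative, so its discriminant is not positive.
  have key : ∀ c : ℝ, 0 ≤ (∫ u, |ρ u| ∂m) * (c * c) + (-2 * ∫ u, |ρ u| * |f u| ∂m) * c +
      ∫ u, |ρ u| * |f u| ^ 2 ∂m := by
    intro c
    have : ∫ u, |ρ u| * (|f u| - c) ^ 2 ∂m = (∫ u, |ρ u| ∂m) * (c * c) +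
        (-2 * ∫ u, |ρ u| * |f u| ∂m) * c + ∫ u, |ρ u| * |f u| ^ 2 ∂m := by
      rw [← integral_mul_const, ← integral_const_mul, ← integral_mul_const, ← integral_add,
        ← integral_add]
      · refine integral_congr_ae (ae_of_all _ fun u => ?_)
        simp only
        ring
      · exact (hρ.abs.mul_const _).add ((h1.const_mul _).mul_const _)
      · exact h2
      · exact hρ.abs.mul_const _
      · exact (h1.const_mul _).mul_const _
    rw [← this]
    exact integral_nonneg fun u => by positivity
  have hd := discrim_le_zero key
  have h3 : |∫ u, ρ u * f u ∂m| ≤ ∫ u, |ρ u| * |f u| ∂m := by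
    simpa [abs_mul] using abs_integral_le_integral_abs (f := fun u => ρ u * f u) (μ := m)
  have h4 : (∫ u, ρ u * f u ∂m) ^ 2 ≤ (∫ u, |ρ u| * |f u| ∂m) ^ 2 := by
    rw [← sq_abs]
    exact pow_le_pow_left₀ (abs_nonneg _) h3 2
  simp only [discrim] at hd
  simp only [abs_mul, abs_pow]
  nlinarith

variable [IsProbabilityMeasure P]

lemma integrable_prod_mul_sq (hρ : Integrable ρ m)
    (hFm : AEStronglyMeasurable (Function.uncurry F) (m.prod P))
    (hF : ∀ᵐ u ∂m, MemLp (F u) 2 P) (hK : ∀ᵐ u ∂m, ∫ ω, F u ω ^ 2 ∂P ≤ K) :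
    Integrable (fun p : E × Ω => ρ p.1 * F p.1 p.2 ^ 2) (m.prod P) := by
  have hm : AEStronglyMeasurable (fun p : E × Ω => ρ p.1 * F p.1 p.2 ^ 2) (m.prod P) :=
    hρ.1.comp_fst.mul (hFm.pow 2)
  refine (integrable_prod_iff hm).2 ⟨?_, ?_⟩
  · filter_upwards [hF] with u hu using hu.integrable_sq.const_mul _
  · refine Integrable.mono' (hρ.abs.mul_const K) hm.norm.integral_prod_right' ?_
    filter_upwards [hK] with u hu
    simp only [norm_mul, norm_pow, Real.norm_eq_abs, sq_abs]
    rw [integral_const_mul, abs_mul, abs_abs, abs_of_nonneg (integral_nonneg fun _ => sq_nonneg _)]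
    gcongr

variable [SFinite m]

lemma memLp_integral_mul (hρ : Integrable ρ m)
    (hFm : AEStronglyMeasurable (Function.uncurry F) (m.prod P))
    (hF : ∀ᵐ u ∂m, MemLp (F u) 2 P) (hK : ∀ᵐ u ∂m, ∫ ω, F u ω ^ 2 ∂P ≤ K) :
    MemLp (fun ω => ∫ u, ρ u * F u ω ∂m) 2 P := by
  have hi := integrable_prod_mul_sq hρ hFm hF hK
  have hm : AEStronglyMeasurable (fun p : E × Ω => ρ p.1 * F p.1 p.2) (m.prod P) :=
    hρ.1.comp_fst.mul hFm
  have hm' : AEStronglyMeasurable (fun ω => ∫ u, ρ u * F u ω ∂m) P :=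
    hm.prod_swap.integral_prod_right'
  refine (memLp_two_iff_integrable_sq hm').2 ?_
  refine Integrable.mono' (hi.swap.integral_norm_prod_left.const_mul (∫ u, |ρ u| ∂m))
    (hm'.pow 2) ?_
  have hFs := hm.prod_swap.prodMk_left
  filter_upwards [hi.swap.prod_right_ae, hFs] with ω hω hω'
  rw [Real.norm_eq_abs, abs_of_nonneg (sq_nonneg _)]
  refine sq_integral_mul_le hρ ?_ hω
  refine Integrable.mono' (hρ.abs.add hω.abs) hω' (ae_of_all _ fun u => ?_)
  simp only [Function.comp, Prod.swap, norm_mul, Real.norm_eq_abs, Pi.add_apply, abs_mul, abs_pow]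
  nlinarith [abs_nonneg (ρ u), mul_nonneg (abs_nonneg (ρ u)) (sq_nonneg (|F u ω| - 1)),
    mul_nonneg (abs_nonneg (ρ u)) (sq_nonneg (|F u ω|))]

/-- Fubini's theorem for a square integrable process tested against `Y ∈ L²`; the integrand is
dominated by `|ρ| (F² + Y²)`. -/
lemma integral_mul_integral_mul (hρ : Integrable ρ m)
    (hFm : AEStronglyMeasurable (Function.uncurry F) (m.prod P))
    (hF : ∀ᵐ u ∂m, MemLp (F u) 2 P) (hK : ∀ᵐ u ∂m, ∫ ω, F u ω ^ 2 ∂P ≤ K)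
    {Y : Ω → ℝ} (hY : MemLp Y 2 P) :
    ∫ ω, Y ω * ∫ u, ρ u * F u ω ∂m ∂P = ∫ u, ρ u * ∫ ω, Y ω * F u ω ∂P ∂m := by
  have hi := integrable_prod_mul_sq hρ hFm hF hK
  have hY2 : Integrable (fun p : E × Ω => ρ p.1 * Y p.2 ^ 2) (m.prod P) :=
    hρ.mul_prod hY.integrable_sq
  have hint : Integrable (fun p : E × Ω => ρ p.1 * (Y p.2 * F p.1 p.2)) (m.prod P) := by
    refine Integrable.mono' (hi.abs.add hY2.abs)
      (hρ.1.comp_fst.mul (hY.1.comp_snd.mul hFm)) (ae_of_all _ fun p => ?_)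
    simp only [norm_mul, Real.norm_eq_abs, Pi.add_apply, abs_mul, abs_pow]
    nlinarith [mul_nonneg (abs_nonneg (ρ p.1)) (sq_nonneg (|F p.1 p.2| - |Y p.2|)),
      mul_nonneg (abs_nonneg (ρ p.1)) (sq_nonneg (|F p.1 p.2|)),
      mul_nonneg (abs_nonneg (ρ p.1)) (sq_nonneg (|Y p.2|))]
  simp_rw [← integral_const_mul, mul_left_comm (Y _)]
  exact (integral_integral_swap (f := fun u ω => ρ u * (Y ω * F u ω)) hint).symm

end TimeIntegral

/-! ### Variation of constants -/

/-- Variation of constants for `z = z 0 + ∫ (A z + C) + F` with a continuous forcing term `F`. The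
integral `∫ Φ dF` is written in the integrated-by-parts form `F T + ∫ Φ A F`. -/
lemma variation_of_constants {T : ℝ} {A C Φ z F : ℝ → ℝ}
    (hA : IntervalIntegrable A volume 0 T) (hC : IntervalIntegrable C volume 0 T)
    (hz : ContinuousOn z (Set.uIcc 0 T)) (hΦ : HasACDeriv Φ (fun u => -A u * Φ u) 0 T)
    (hΦT : Φ T = 1) (hF : ∀ u, F u = z u - z 0 - ∫ v in (0 : ℝ)..u, (A v * z v + C v)) :
    z T = Φ 0 * z 0 + (∫ u in (0 : ℝ)..T, Φ u * C u) +
      (F T + ∫ u in (0 : ℝ)..T, Φ u * A u * F u) := by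
  have hAz : IntervalIntegrable (fun v => A v * z v + C v) volume 0 T :=
    (hA.mul_continuousOn hz).add hC
  have hY := (hasACDeriv_integral hAz).const_add (z 0)
  have hYF : ∀ u, z 0 + ∫ v in (0 : ℝ)..u, (A v * z v + C v) = z u - F u := fun u => by
    rw [hF]
    ring
  have hFc : ContinuousOn F (Set.uIcc 0 T) := by
    refine (hz.sub hY.continuousOn).congr fun u _ => ?_
    simp only [hYF, Pi.sub_apply]
    ring
  have h := (hΦ.mul hY).integral_eq_sub
  simp only [hYF] at h
  have h1 : ∀ u, -A u * Φ u * (z u - F u) + Φ u * (A u * z u + C u) =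
      Φ u * C u + Φ u * A u * F u := fun u => by ring
  simp_rw [h1] at h
  rw [intervalIntegral.integral_add (hC.continuousOn_mul hΦ.continuousOn)
    ((hA.continuousOn_mul hΦ.continuousOn).mul_continuousOn hFc), hΦT] at h
  have hF0 : F 0 = 0 := by simp [hF]
  rw [hF0] at h
  linarith

/-! ### Second moments of the weighted noise -/

section WeightedNoise

variable {Ω : Type*} {mΩ : MeasurableSpace Ω} {P : Measure Ω} {T : ℝ}
  {A q Φ : ℝ → ℝ} {F : ℝ → Ω → ℝ}

/-- The covariance of `F v` with `F T + ∫ Φ A F`, when `F u` and `F v` have covariance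
`S (min u v)` with `S u = ∫₀ᵘ q`. It comes from integrating `(Φ S)'` over `[0, v]` and `Φ'` over
`[v, T]`. -/
lemma covariance_weighted {v : ℝ} (hv : v ∈ Set.Icc 0 T) (hq : IntervalIntegrable q volume 0 T)
    (hΦ : HasACDeriv Φ (fun u => -A u * Φ u) 0 T) (hΦT : Φ T = 1) :
    (∫ r in (0 : ℝ)..v, q r) + ∫ u in (0 : ℝ)..T, Φ u * A u * ∫ r in (0 : ℝ)..(min u v), q r =
      ∫ u in (0 : ℝ)..v, Φ u * q u := by
  obtain ⟨hv0, hvT⟩ := hv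
  have hsub : Set.uIcc 0 v ⊆ Set.uIcc 0 T := by
    rw [Set.uIcc_of_le hv0, Set.uIcc_of_le (hv0.trans hvT)]
    exact Set.Icc_subset_Icc_right hvT
  have hsub' : Set.uIcc v T ⊆ Set.uIcc 0 T := by
    rw [Set.uIcc_of_le hvT, Set.uIcc_of_le (hv0.trans hvT)]
    exact Set.Icc_subset_Icc_left hv0
  have hS := (hasACDeriv_integral hq)
  have hΦ0 := hΦ.mono hsub
  have hS0 := hS.mono hsub
  have hΦ1 := hΦ.mono hsub'
  have h1 := (hΦ0.mul hS0).integral_eq_sub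
  rw [intervalIntegral.integral_add (hΦ0.intervalIntegrable.mul_continuousOn hS0.continuousOn)
    (hS0.intervalIntegrable.continuousOn_mul hΦ0.continuousOn)] at h1
  have h2 := hΦ1.integral_eq_sub
  have e1 : ∫ u in (0 : ℝ)..v, Φ u * A u * ∫ r in (0 : ℝ)..(min u v), q r =
      -∫ u in (0 : ℝ)..v, -A u * Φ u * ∫ r in (0 : ℝ)..u, q r := by
    rw [← intervalIntegral.integral_neg]
    refine intervalIntegral.integral_congr fun u hu => ?_
    rw [Set.uIcc_of_le hv0] at hu
    simp only [min_eq_left hu.2]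
    ring
  have e2 : ∫ u in v..T, Φ u * A u * ∫ r in (0 : ℝ)..(min u v), q r =
      -((∫ u in v..T, -A u * Φ u) * ∫ r in (0 : ℝ)..v, q r) := by
    rw [← intervalIntegral.integral_mul_const, ← intervalIntegral.integral_neg]
    refine intervalIntegral.integral_congr fun u hu => ?_
    rw [Set.uIcc_of_le hvT] at hu
    simp only [min_eq_right hu.1]
    ring
  have i1 : IntervalIntegrable (fun u => Φ u * A u * ∫ r in (0 : ℝ)..(min u v), q r)
      volume 0 v := by
    refine (hΦ0.intervalIntegrable.mul_continuousOn hS0.continuousOn).neg.congr fun u hu => ?_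
    rw [Set.uIoc_of_le hv0] at hu
    simp only [min_eq_left hu.2, Pi.neg_apply]
    ring
  have i2 : IntervalIntegrable (fun u => Φ u * A u * ∫ r in (0 : ℝ)..(min u v), q r)
      volume v T := by
    refine (hΦ1.intervalIntegrable.mul_const (∫ r in (0 : ℝ)..v, q r)).neg.congr fun u hu => ?_
    rw [Set.uIoc_of_le hvT] at hu
    simp only [min_eq_right hu.1.le, Pi.neg_apply]
    ring
  rw [← intervalIntegral.integral_add_adjacent_intervals i1 i2, e1, e2, h2, hΦT]
  simp only [intervalIntegral.integral_same] at h1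
  linarith

variable [IsProbabilityMeasure P]

/-- If `F` has the covariance of a time-changed Brownian motion, then
`W = F T + ∫ Φ A F = ∫ Φ dF` is square integrable with `E W² = ∫ Φ² q`, and it is uncorrelated
with everything that all `F u` are uncorrelated with. -/
lemma moments_weighted_noise (hT : 0 ≤ T) (hA : IntervalIntegrable A volume 0 T)
    (hq : IntervalIntegrable q volume 0 T)
    (hΦ : HasACDeriv Φ (fun u => -A u * Φ u) 0 T) (hΦT : Φ T = 1)
    (hFm : Measurable (Function.uncurry F)) (hF : ∀ u ∈ Set.Icc 0 T, MemLp (F u) 2 P)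
    (hcov : ∀ u ∈ Set.Icc 0 T, ∀ v ∈ Set.Icc 0 T,
      ∫ ω, F u ω * F v ω ∂P = ∫ r in (0 : ℝ)..(min u v), q r)
    {W : Ω → ℝ} (hW : ∀ ω, W ω = F T ω + ∫ u in (0 : ℝ)..T, Φ u * A u * F u ω) :
    MemLp W 2 P ∧ (∫ ω, W ω ^ 2 ∂P = ∫ u in (0 : ℝ)..T, Φ u ^ 2 * q u) ∧
      ∀ Y : Ω → ℝ, MemLp Y 2 P → (∀ u ∈ Set.Icc 0 T, ∫ ω, Y ω * F u ω ∂P = 0) →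
        ∫ ω, Y ω * W ω ∂P = 0 := by
  have hTm : T ∈ Set.Icc 0 T := Set.right_mem_Icc.2 hT
  have hmem : ∀ᵐ u ∂volume.restrict (Set.Ioc 0 T), u ∈ Set.Icc 0 T := by
    filter_upwards [ae_restrict_mem measurableSet_Ioc] with u hu using Set.Ioc_subset_Icc_self hu
  have hρ : Integrable (fun u => Φ u * A u) (volume.restrict (Set.Ioc 0 T)) :=
    (intervalIntegrable_iff_integrableOn_Ioc_of_le hT).1 (hA.continuousOn_mul hΦ.continuousOn)
  have hF' : ∀ᵐ u ∂volume.restrict (Set.Ioc 0 T), MemLp (F u) 2 P := by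
    filter_upwards [hmem] with u hu using hF u hu
  have hS := hasACDeriv_integral hq
  obtain ⟨K, hK⟩ := hS.ac.exists_bound
  have hK' : ∀ᵐ u ∂volume.restrict (Set.Ioc 0 T), ∫ ω, F u ω ^ 2 ∂P ≤ K := by
    filter_upwards [hmem] with u hu
    simp_rw [sq]
    rw [hcov u hu u hu, min_self]
    exact (le_abs_self _).trans (hK u (by rwa [Set.uIcc_of_le hT]))
  have hX := memLp_integral_mul hρ hFm.aestronglyMeasurable hF' hK'
  have hW' : W = fun ω => F T ω + ∫ u in Set.Ioc 0 T, Φ u * A u * F u ω := by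
    ext ω
    rw [hW, intervalIntegral.integral_of_le hT]
  have hW2 : MemLp W 2 P := by
    rw [hW']
    exact (hF T hTm).add hX
  have hYW : ∀ Y : Ω → ℝ, MemLp Y 2 P → ∫ ω, Y ω * W ω ∂P = (∫ ω, Y ω * F T ω ∂P) +
      ∫ u in (0 : ℝ)..T, Φ u * A u * ∫ ω, Y ω * F u ω ∂P := by
    intro Y hY
    rw [intervalIntegral.integral_of_le hT,
      ← integral_mul_integral_mul hρ hFm.aestronglyMeasurable hF' hK' hY, hW']
    simp only [mul_add]
    exact integral_add (hY.integrable_mul (hF T hTm)) (hY.integrable_mul hX)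
  have hFW : ∀ v ∈ Set.Icc 0 T, ∫ ω, W ω * F v ω ∂P = ∫ u in (0 : ℝ)..v, Φ u * q u := by
    intro v hv
    rw [show ∫ ω, W ω * F v ω ∂P = ∫ ω, F v ω * W ω ∂P by simp only [mul_comm],
      hYW _ (hF v hv), ← covariance_weighted hv hq hΦ hΦT, hcov v hv T hTm,
      min_eq_left hv.2]
    congr 1
    refine intervalIntegral.integral_congr fun u hu => ?_
    rw [Set.uIcc_of_le hT] at hu
    rw [hcov v hv u hu, min_comm]
  refine ⟨hW2, ?_, ?_⟩
  · rw [show ∫ ω, W ω ^ 2 ∂P = ∫ ω, W ω * W ω ∂P by simp only [sq], hYW W hW2, hFW T hTm]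
    -- With `K v = E[W F v] = ∫₀ᵛ Φ q`, the identity `(Φ K)' = -Φ A K + Φ² q` gives the claim.
    have hK := hasACDeriv_integral (hq.continuousOn_mul hΦ.continuousOn)
    have h := (hΦ.mul hK).integral_eq_sub
    rw [intervalIntegral.integral_add (hΦ.intervalIntegrable.mul_continuousOn hK.continuousOn)
      (hK.intervalIntegrable.continuousOn_mul hΦ.continuousOn), hΦT] at h
    simp only [intervalIntegral.integral_same] at h
    have e1 : ∫ u in (0 : ℝ)..T, Φ u * A u * ∫ ω, W ω * F u ω ∂P =
        -∫ u in (0 : ℝ)..T, -A u * Φ u * ∫ r in (0 : ℝ)..u, Φ r * q r := by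
      rw [← intervalIntegral.integral_neg]
      refine intervalIntegral.integral_congr fun u hu => ?_
      rw [Set.uIcc_of_le hT] at hu
      simp only [hFW u hu]
      ring
    have e2 : ∫ u in (0 : ℝ)..T, Φ u ^ 2 * q u = ∫ u in (0 : ℝ)..T, Φ u * (Φ u * q u) := by
      congr 1
      ext u
      ring
    rw [e1, e2]
    linarith
  · intro Y hY hYF
    rw [hYW Y hY, hYF T hTm, zero_add]
    refine (intervalIntegral.integral_congr (g := fun _ => (0 : ℝ)) fun u hu => ?_).trans (by simp)
    rw [Set.uIcc_of_le hT] at hu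
    simp only [hYF u hu, mul_zero]

end WeightedNoise

/-! ### Moments of a linear stochastic differential equation -/

/-- An integrable function on `(0, T]` has a Borel measurable version which is integrable on the
whole line. -/
lemma exists_measurable_integrable_version {T : ℝ} (hT : 0 ≤ T) {f : ℝ → ℝ}
    (hf : IntervalIntegrable f volume 0 T) :
    ∃ g : ℝ → ℝ, Measurable g ∧ Integrable g ∧ ∀ᵐ u, u ∈ Set.Ioc 0 T → f u = g u := by
  have hf' := (intervalIntegrable_iff_integrableOn_Ioc_of_le hT).1 hf
  have hae := hf'.1.ae_eq_mk
  refine ⟨(Set.Ioc 0 T).indicator (hf'.1.mk f),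
    hf'.1.stronglyMeasurable_mk.measurable.indicator measurableSet_Ioc,
    (integrable_indicator_iff measurableSet_Ioc).2 (hf'.congr hae), ?_⟩
  filter_upwards [(ae_restrict_iff' measurableSet_Ioc).1 hae] with u hu hum
  rw [Set.indicator_of_mem hum, hu hum]

section

variable {Ω : Type*} {mΩ : MeasurableSpace Ω} {P : Measure Ω}

/-- A process with almost surely continuous paths on `[0, T]`, redefined on a null set and frozen
outside `[0, T]`. -/
lemma exists_continuous_version {T : ℝ≥0} {Z : ℝ≥0 → Ω → ℝ} (hm : ∀ t ≤ T, Measurable (Z t))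
    (hc : ∀ᵐ ω ∂P, ContinuousOn (fun t => Z t ω) (Set.Icc 0 T)) :
    ∃ z : ℝ → Ω → ℝ, (∀ u, Measurable (z u)) ∧ (∀ ω, Continuous fun u => z u ω) ∧
      ∀ᵐ ω ∂P, ∀ t ≤ T, z t ω = Z t ω := by
  -- The set of discontinuous paths need not be measurable.
  set N := toMeasurable P {ω | ¬ ContinuousOn (fun t => Z t ω) (Set.Icc 0 T)} with hN
  have hNm : MeasurableSet N := measurableSet_toMeasurable _ _
  have hN0 : P N = 0 := by
    rw [hN, measure_toMeasurable]
    exact hc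
  refine ⟨fun u => Nᶜ.indicator (Z (min u.toNNReal T)),
    fun u => (hm _ (min_le_right _ _)).indicator hNm.compl, fun ω => ?_, ?_⟩
  · by_cases hω : ω ∈ Nᶜ
    · simp only [Set.indicator_of_mem hω]
      have hcω : ContinuousOn (fun t => Z t ω) (Set.Icc 0 T) := by
        by_contra h
        exact hω (subset_toMeasurable _ _ h)
      refine hcω.comp_continuous (f := fun u : ℝ => min u.toNNReal T) ?_
        fun u => ⟨zero_le, min_le_right _ _⟩
      exact continuous_real_toNNReal.min continuous_const
    · simp only [Set.indicator_of_notMem hω]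
      exact continuous_const
  · filter_upwards [measure_eq_zero_iff_ae_notMem.1 hN0] with ω hω t ht
    rw [Set.indicator_of_mem (by exact hω), Real.toNNReal_coe, min_eq_left ht]

variable [IsProbabilityMeasure P]

/-- Mean and variance of the solution of `dZ = (A Z + C) dt + s dB`, where `Φ t = exp (∫ₜᵀ A)`. -/
theorem IsSDESolution.linear_moments {b : ℝ → ℝ → ℝ} {s A C Φ : ℝ → ℝ} {T : ℝ≥0}
    {𝓕 : Filtration ℝ≥0 mΩ} {B Z : ℝ≥0 → Ω → ℝ} (hZ : IsSDESolution b s T 𝓕 B P Z)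
    (hZ0 : MemLp (Z 0) 2 P) (hb : ∀ u ∈ Set.Icc 0 (T : ℝ), ∀ x, b u x = A u * x + C u)
    (hA : IntervalIntegrable A volume 0 T) (hC : IntervalIntegrable C volume 0 T)
    (hs : MemLp s 2 (volume.restrict (Set.Ioc 0 (T : ℝ))))
    (hΦ : HasACDeriv Φ (fun u => -A u * Φ u) 0 T) (hΦT : Φ T = 1) :
    MemLp (Z T) 2 P ∧
      (∫ ω, Z T ω ∂P = Φ 0 * (∫ ω, Z 0 ω ∂P) + ∫ u in (0 : ℝ)..T, Φ u * C u) ∧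
      variance (Z T) P =
        Φ 0 ^ 2 * variance (Z 0) P + ∫ u in (0 : ℝ)..T, Φ u ^ 2 * s u ^ 2 := by
  have hT : (0 : ℝ) ≤ T := T.coe_nonneg
  have hpre := hZ.brownian.isBrownian.toIsPreBrownianReal
  obtain ⟨a, ham, hai, haA⟩ := exists_measurable_integrable_version hT hA
  obtain ⟨c, hcm, hci, hcC⟩ := exists_measurable_integrable_version hT hC
  obtain ⟨z, hzm, hzc, hzZ⟩ := exists_continuous_version (P := P)
    (fun t ht => (hZ.adapted t ht).mono (𝓕.le t) le_rfl) hZ.continuous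
  have hdr : ∀ ω x y, IntervalIntegrable (fun v => a v * z v ω + c v) volume x y := fun ω x y =>
    (hai.intervalIntegrable.mul_continuousOn (hzc ω).continuousOn).add hci.intervalIntegrable
  -- The noise, reconstructed pathwise from the equation: continuous in time for every `ω`.
  set F : ℝ → Ω → ℝ := fun u ω =>
    z u ω - z 0 ω - ∫ v in (0 : ℝ)..u, (a v * z v ω + c v) with hFdef
  have hzj : Measurable (Function.uncurry z) :=
    measurable_uncurry_of_continuous_of_measurable hzc hzm
  have hdm : Measurable (fun p : Ω × ℝ => a p.2 * z p.2 p.1 + c p.2) :=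
    ((ham.comp measurable_snd).mul (hzj.comp measurable_swap)).add (hcm.comp measurable_snd)
  have hFu : ∀ u, Measurable (F u) := by
    intro u
    refine ((hzm u).sub (hzm 0)).sub ?_
    simp only [intervalIntegral]
    exact (hdm.stronglyMeasurable.integral_prod_right'.measurable).sub
      hdm.stronglyMeasurable.integral_prod_right'.measurable
  have hFc : ∀ ω, Continuous fun u => F u ω := fun ω =>
    ((hzc ω).sub continuous_const).sub
      (intervalIntegral.continuous_primitive (hdr ω) 0)
  have hFm : Measurable (Function.uncurry F) :=
    measurable_uncurry_of_continuous_of_measurable hFc hFu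
  -- Measurability of the given versions `I` is not assumed; it is inherited from `F`.
  have hFI : ∀ t ≤ T, IsStochasticIntegral B P s t (F t) := by
    intro t ht
    obtain ⟨I, hI, hIe⟩ := hZ.equation t ht
    refine hI.congr_ae ?_
    filter_upwards [hIe, hzZ] with ω h1 h2
    have e : ∫ u in (0 : ℝ)..t, b u (Z u.toNNReal ω) =
        ∫ v in (0 : ℝ)..t, (a v * z v ω + c v) := by
      refine intervalIntegral.integral_congr_ae ?_
      filter_upwards [haA, hcC] with u hu hu' hum
      rw [Set.uIoc_of_le t.coe_nonneg] at hum
      have huT : u ∈ Set.Ioc 0 (T : ℝ) := ⟨hum.1, hum.2.trans (NNReal.coe_le_coe.2 ht)⟩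
      have hz := h2 u.toNNReal (Real.toNNReal_le_iff_le_coe.2 huT.2)
      rw [Real.coe_toNNReal _ hum.1.le] at hz
      rw [hb u ⟨huT.1.le, huT.2⟩, hu huT, hu' huT, hz]
    have h20 := h2 0 zero_le
    rw [NNReal.coe_zero] at h20
    simp only [hFdef]
    rw [h2 t ht, h20, ← e, h1]
    ring
  have hFI' : ∀ u ∈ Set.Icc 0 (T : ℝ), IsStochasticIntegral B P s u.toNNReal (F u) := by
    intro u hu
    have := hFI u.toNNReal (Real.toNNReal_le_iff_le_coe.2 hu.2)
    rwa [Real.coe_toNNReal _ hu.1] at this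
  have hFs : ∀ u, AEStronglyMeasurable (F u) P := fun u => (hFu u).aestronglyMeasurable
  have hq : IntervalIntegrable (fun u => s u ^ 2) volume 0 T :=
    (intervalIntegrable_iff_integrableOn_Ioc_of_le hT).2 hs.integrable_sq
  have hcov : ∀ u ∈ Set.Icc 0 (T : ℝ), ∀ v ∈ Set.Icc 0 (T : ℝ),
      ∫ ω, F u ω * F v ω ∂P = ∫ r in (0 : ℝ)..(min u v), s r ^ 2 := by
    intro u hu v hv
    have hle : (((min u.toNNReal v.toNNReal : ℝ≥0) : ℝ)) = min u v := by
      rw [NNReal.coe_min, Real.coe_toNNReal _ hu.1, Real.coe_toNNReal _ hv.1]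
    rw [(hFI' u hu).integral_mul hpre (hFI' v hv) (hFs u) (hFs v), hle,
      intervalIntegral.integral_of_le (le_min hu.1 hv.1)]
    rw [hle]
    exact hs.mono_measure
      (Measure.restrict_mono (Set.Ioc_subset_Ioc_right ((min_le_left _ _).trans hu.2)) le_rfl)
  have hai' : IntervalIntegrable a volume 0 T := hai.intervalIntegrable
  have hci' : IntervalIntegrable c volume 0 T := hci.intervalIntegrable
  have hΦ' : HasACDeriv Φ (fun u => -a u * Φ u) 0 T := by
    refine hΦ.congr_deriv ?_
    filter_upwards [haA] with u hu hum
    rw [Set.uIoc_of_le hT] at hum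
    rw [hu hum]
  have hvar := fun ω => variation_of_constants (F := fun u => F u ω) hai' hci'
    (hzc ω).continuousOn hΦ' hΦT (fun u => rfl)
  set W : Ω → ℝ := fun ω => F T ω + ∫ u in (0 : ℝ)..T, Φ u * a u * F u ω with hWdef
  obtain ⟨hW2, hWsq, hWorth⟩ := moments_weighted_noise hT hai' hq hΦ' hΦT hFm
    (fun u hu => (hFI' u hu).memLp hpre (hFs u)) hcov (W := W) (fun ω => rfl)
  have hW1 : ∫ ω, W ω ∂P = 0 := by
    have h1 : MemLp (fun _ : Ω => (1 : ℝ)) 2 P := memLp_const 1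
    have := hWorth (fun _ => 1) h1 fun u hu => (hFI' u hu).integral_mul_eq_zero hpre (hFs u) h1
      fun p => by simpa using hpre.integral_eval p
    simpa using this
  have hWZ : ∫ ω, Z 0 ω * W ω ∂P = 0 :=
    hWorth (Z 0) hZ0 fun u hu => (hFI' u hu).integral_mul_eq_zero hpre (hFs u) hZ0
      fun p => hZ.brownian.integral_mul_eq_zero (hZ.adapted 0 zero_le) p
  have hcC' : ∫ u in (0 : ℝ)..T, Φ u * c u = ∫ u in (0 : ℝ)..T, Φ u * C u := by
    refine intervalIntegral.integral_congr_ae ?_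
    filter_upwards [hcC] with u hu hum
    rw [Set.uIoc_of_le hT] at hum
    rw [hu hum]
  have hrep : Z T =ᵐ[P] fun ω => (Φ 0 * Z 0 ω + W ω) + ∫ u in (0 : ℝ)..T, Φ u * C u := by
    filter_upwards [hzZ] with ω hω
    have h0 := hω 0 zero_le
    rw [NNReal.coe_zero] at h0
    have h := hvar ω
    rw [hω T le_rfl, h0, hcC'] at h
    rw [h]
    simp only [hWdef]
    ring
  have hsum : MemLp (fun ω => Φ 0 * Z 0 ω + W ω) 2 P := (hZ0.const_mul _).add hW2
  have hZ1 := hZ0.integrable one_le_two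
  have hW1' := hW2.integrable one_le_two
  refine ⟨(memLp_congr_ae hrep).2 (hsum.add (memLp_const _)), ?_, ?_⟩
  · rw [integral_congr_ae hrep, integral_add (hsum.integrable one_le_two) (integrable_const _),
      integral_add (hZ1.const_mul _) hW1', integral_const_mul, hW1]
    simp
  · rw [variance_congr hrep, variance_add_const hsum.1,
      variance_fun_add (hZ0.const_mul _) hW2, variance_const_mul,
      variance_eq_sub hW2, covariance_eq_sub (hZ0.const_mul _) hW2, hW1]
    have e : P[(fun ω => Φ 0 * Z 0 ω) * W] = 0 := by
      simp only [Pi.mul_apply, mul_assoc]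
      rw [integral_const_mul, hWZ, mul_zero]
    rw [e]
    simp only [Pi.pow_apply]
    rw [hWsq]
    ring

end

/-! ### The guided reverse diffusion -/

lemma sqrt_one_sub_lam (β : ℝ → ℝ) (t : ℝ) :
    Real.sqrt (1 - lam β t) = Real.exp (-∫ s in (0 : ℝ)..t, β s) := by
  rw [lam, sub_sub_cancel, Real.sqrt_eq_iff_mul_self_eq_of_pos (Real.exp_pos _), ← Real.exp_add]
  congr 1
  ring

/-- For a Gaussian target the guided drift is affine in the space variable. -/
lemma drift_eq {μ σ 𝒵 : ℝ} (hσ : 0 < σ) {γ : ℝ → ℝ} (h𝒵 : 0 < 𝒵)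
    (hγ : ∀ x, gaussianPDFReal μ (σ ^ 2).toNNReal x = γ x / 𝒵) (β : ℝ → ℝ) (T t x : ℝ) :
    drift β γ T t x =
      -(β (T - t) * (1 + 2 * (1 / σ ^ 2 - 1) * Real.exp (-∫ s in (0 : ℝ)..(T - t), β s) ^ 2)) * x +
        2 * β (T - t) * Real.exp (-∫ s in (0 : ℝ)..(T - t), β s) * (μ / σ ^ 2) := by
  set r := Real.exp (-∫ s in (0 : ℝ)..(T - t), β s) with hr
  have hσ2 : ((σ ^ 2).toNNReal : ℝ) = σ ^ 2 := Real.coe_toNNReal _ (sq_nonneg σ)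
  have hv : (σ ^ 2).toNNReal ≠ 0 := by
    rw [← NNReal.coe_ne_zero, hσ2]
    positivity
  have hlog : ∀ (m : ℝ) (v : ℝ≥0) (y : ℝ), v ≠ 0 → Real.log (gaussianPDFReal m v y) =
      Real.log (Real.sqrt (2 * Real.pi * v))⁻¹ - (y - m) ^ 2 / (2 * v) := by
    intro m v y hv
    have hv' : (0 : ℝ) < v := NNReal.coe_pos.2 (pos_iff_ne_zero.2 hv)
    rw [gaussianPDFReal, Real.log_mul (by positivity) (Real.exp_ne_zero _), Real.log_exp]
    ring
  have hfun : (fun y => Real.log (gHat β γ (T - t) y)) = fun y =>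
      (Real.log 𝒵 + Real.log (Real.sqrt (2 * Real.pi * (σ ^ 2).toNNReal))⁻¹ -
        Real.log (Real.sqrt (2 * Real.pi * (1 : ℝ≥0)))⁻¹) +
      ((r * y) ^ 2 / 2 - (r * y - μ) ^ 2 / (2 * σ ^ 2)) := by
    ext y
    have hg : γ (r * y) = 𝒵 * gaussianPDFReal μ (σ ^ 2).toNNReal (r * y) := by
      rw [hγ]
      field_simp
    rw [gHat, sqrt_one_sub_lam, ← hr, g0, hg,
      Real.log_div (mul_pos h𝒵 (gaussianPDFReal_pos _ _ _ hv)).ne'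
        (gaussianPDFReal_pos _ _ _ one_ne_zero).ne',
      Real.log_mul h𝒵.ne' (gaussianPDFReal_pos _ _ _ hv).ne', hlog _ _ _ hv,
      hlog _ _ _ one_ne_zero, hσ2]
    simp only [NNReal.coe_one]
    ring
  have hd : HasDerivAt (fun y => Real.log (gHat β γ (T - t) y))
      (r ^ 2 * x - r * (r * x - μ) / σ ^ 2) x := by
    rw [hfun]
    have h1 : HasDerivAt (fun y : ℝ => r * y) r x := by simpa using (hasDerivAt_id x).const_mul r
    refine ((((h1.pow 2).div_const 2).sub
      (((h1.sub_const μ).pow 2).div_const (2 * σ ^ 2))).const_add _).congr_deriv ?_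
    field_simp
    ring
  rw [drift, hd.deriv]
  field_simp
  ring

/-- Mean and variance at a finite horizon. For `k = 0`, that is `σ = 1`, the primitives of the
integrands take a different form. -/
theorem guided_moments {μ σ 𝒵 : ℝ} (hσ : 0 < σ) {γ : ℝ → ℝ} (h𝒵 : 0 < 𝒵)
    (hγ : ∀ x, gaussianPDFReal μ (σ ^ 2).toNNReal x = γ x / 𝒵)
    {β : ℝ → ℝ} (hβ_pos : ∀ t, 0 ≤ t → 0 < β t) {T : ℝ≥0}
    (hβ_int : IntervalIntegrable β volume 0 T)
    {Ω : Type*} {mΩ : MeasurableSpace Ω} {P : Measure Ω} [IsProbabilityMeasure P]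
    {𝓕 : Filtration ℝ≥0 mΩ} {B Z : ℝ≥0 → Ω → ℝ} (hZ0 : HasLaw (Z 0) (gaussianReal 0 1) P)
    (hZ : IsSDESolution (drift β γ T) (diffusionCoeff β T) T 𝓕 B P Z)
    {k h : ℝ} (hk : k = 1 / σ ^ 2 - 1) (hh : h = Real.exp (-∫ s in (0 : ℝ)..T, β s)) :
    MemLp (Z T) 2 P ∧
      (k ≠ 0 → ∫ ω, Z T ω ∂P = μ / σ ^ 2 / k * (1 - Real.exp (-k + k * (h * h))) ∧
        variance (Z T) P = (h * Real.exp (-k + k * (h * h))) ^ 2 +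
          1 / (2 * k) * (1 - Real.exp (-k + k * (h * h)) ^ 2)) ∧
      (k = 0 → ∫ ω, Z T ω ∂P = μ / σ ^ 2 * (1 - h * h) ∧ variance (Z T) P = 1) := by
  have hT : (0 : ℝ) ≤ T := T.coe_nonneg
  have hrev : IntervalIntegrable (fun u => β (T - u)) volume 0 T := by
    simpa using (hβ_int.comp_sub_left (T : ℝ)).symm
  -- `e u = exp (-∫₀^{T-u} β)` in forward form, and `Q u = exp (-k (1 - e u ^ 2))`.
  set e : ℝ → ℝ := fun u => Real.exp ((-∫ s in (0 : ℝ)..T, β s) + ∫ v in (0 : ℝ)..u, β (T - v))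
    with hedef
  have he_eq : ∀ u ∈ Set.Icc 0 (T : ℝ), Real.exp (-∫ s in (0 : ℝ)..(T - u), β s) = e u := by
    intro u hu
    have h1 : ∫ v in (0 : ℝ)..u, β (T - v) = ∫ s in (T - u)..T, β s := by
      rw [intervalIntegral.integral_comp_sub_left (f := β), sub_zero]
    have hm : (T : ℝ) - u ∈ Set.uIcc 0 (T : ℝ) := by
      rw [Set.uIcc_of_le hT]
      exact ⟨sub_nonneg.2 hu.2, sub_le_self _ hu.1⟩
    simp only [hedef]
    rw [h1, ← intervalIntegral.integral_add_adjacent_intervals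
      (hβ_int.mono_set (Set.uIcc_subset_uIcc_left hm))
      (hβ_int.mono_set (Set.uIcc_subset_uIcc_right hm))]
    congr 1
    ring
  have he := ((hasACDeriv_integral hrev).const_add (-∫ s in (0 : ℝ)..T, β s)).exp
  change HasACDeriv e (fun u => e u * β (T - u)) 0 T at he
  have hee := he.mul he
  set Q : ℝ → ℝ := fun u => Real.exp (-k + k * (e u * e u)) with hQdef
  have hQ := ((hee.const_mul k).const_add (-k)).exp
  change HasACDeriv Q
    (fun u => Q u * (k * (e u * β (T - u) * e u + e u * (e u * β (T - u))))) 0 T at hQ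
  have he0 : e 0 = h := by simp [hedef, hh]
  have heT : e T = 1 := by
    rw [← he_eq T ⟨hT, le_rfl⟩]
    simp
  have hQ0 : Q 0 = Real.exp (-k + k * (h * h)) := by simp only [hQdef, he0]
  have hQT : Q T = 1 := by simp [hQdef, heT]
  have hQ1 : k = 0 → ∀ u, Q u = 1 := fun hk0 u => by simp [hQdef, hk0]
  have hec := he.continuousOn
  have hΦ : HasACDeriv (fun u => e u * Q u)
      (fun u => -(-(β (T - u) * (1 + 2 * k * e u ^ 2))) * (e u * Q u)) 0 T :=
    (he.mul hQ).congr_deriv (ae_of_all _ fun u _ => by ring)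
  have hA : IntervalIntegrable (fun u => -(β (T - u) * (1 + 2 * k * e u ^ 2))) volume 0 T :=
    (hrev.mul_continuousOn (continuousOn_const.add (continuousOn_const.mul (hec.pow 2)))).neg
  have hC : IntervalIntegrable (fun u => 2 * β (T - u) * e u * (μ / σ ^ 2)) volume 0 T :=
    ((hrev.const_mul 2).mul_continuousOn hec).mul_const _
  have hrev' : IntegrableOn (fun u => β (T - u)) (Set.Ioc 0 (T : ℝ)) :=
    (intervalIntegrable_iff_integrableOn_Ioc_of_le hT).1 hrev
  have hs2 : ∀ u ∈ Set.Icc 0 (T : ℝ), diffusionCoeff β T u ^ 2 = 2 * β (T - u) := fun u hu =>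
    Real.sq_sqrt (by linarith [hβ_pos (T - u) (sub_nonneg.2 hu.2)])
  have hs : MemLp (diffusionCoeff β T) 2 (volume.restrict (Set.Ioc (0 : ℝ) (T : ℝ))) := by
    refine (memLp_two_iff_integrable_sq
      (Real.continuous_sqrt.comp_aestronglyMeasurable (hrev'.1.const_mul 2))).2 ?_
    refine (hrev'.const_mul 2).congr ?_
    filter_upwards [ae_restrict_mem measurableSet_Ioc] with u hu
    exact (hs2 u (Set.Ioc_subset_Icc_self hu)).symm
  have hb : ∀ u ∈ Set.Icc 0 (T : ℝ), ∀ x, drift β γ T u x =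
      -(β (T - u) * (1 + 2 * k * e u ^ 2)) * x + 2 * β (T - u) * e u * (μ / σ ^ 2) := by
    intro u hu x
    rw [drift_eq hσ h𝒵 hγ, he_eq u hu, hk]
  obtain ⟨hM, hmean, hvar⟩ := hZ.linear_moments hZ0.hasGaussianLaw.memLp_two hb hA hC hs hΦ
    (by simp [heT, hQT])
  rw [hZ0.integral_eq, integral_id_gaussianReal] at hmean
  rw [hZ0.variance_eq, variance_id_gaussianReal] at hvar
  have hvar' : ∫ u in (0 : ℝ)..T, (e u * Q u) ^ 2 * diffusionCoeff β T u ^ 2 =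
      ∫ u in (0 : ℝ)..T, (e u * Q u) ^ 2 * (2 * β (T - u)) := by
    refine intervalIntegral.integral_congr fun u hu => ?_
    rw [Set.uIcc_of_le hT] at hu
    simp only [hs2 u hu]
  simp only [hvar', he0, hQ0] at hvar hmean
  refine ⟨hM, fun hk0 => ⟨?_, ?_⟩, fun hk0 => ⟨?_, ?_⟩⟩
  · have hp := (hQ.const_mul (μ / σ ^ 2 / k)).congr_deriv
      (g := fun u => e u * Q u * (2 * β (T - u) * e u * (μ / σ ^ 2)))
      (ae_of_all _ fun u _ => by field_simp; ring)
    rw [hmean, hp.integral_eq_sub, hQT, hQ0]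
    ring
  · have hp := ((hQ.mul hQ).const_mul (1 / (2 * k))).congr_deriv
      (g := fun u => (e u * Q u) ^ 2 * (2 * β (T - u)))
      (ae_of_all _ fun u _ => by field_simp; ring)
    rw [hvar, hp.integral_eq_sub, hQT, hQ0]
    simp only [NNReal.coe_one]
    ring
  · have hp := (hee.const_mul (μ / σ ^ 2)).congr_deriv
      (g := fun u => e u * Q u * (2 * β (T - u) * e u * (μ / σ ^ 2)))
      (ae_of_all _ fun u _ => by rw [hQ1 hk0 u]; ring)
    rw [hmean, hp.integral_eq_sub, heT, he0]
    ring
  · have hp := hee.congr_deriv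
      (g := fun u => (e u * Q u) ^ 2 * (2 * β (T - u)))
      (ae_of_all _ fun u _ => by rw [hQ1 hk0 u]; ring)
    rw [hvar, hp.integral_eq_sub, heT, he0, hk0]
    simp only [NNReal.coe_one, zero_mul, neg_zero, add_zero, Real.exp_zero]
    ring

/-! ### The limits differ from the target moments -/

lemma exp_neg_ne {σ : ℝ} (hσ : 0 < σ) (hσ1 : σ ≠ 1) :
    Real.exp (-(1 / σ ^ 2 - 1)) ≠ σ ^ 2 := by
  intro h
  have hk : 1 / σ ^ 2 - 1 ≠ 0 := by
    intro h0
    rw [h0, neg_zero, Real.exp_zero] at h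
    nlinarith [mul_pos hσ hσ, sq_nonneg (σ - 1), mul_self_pos.2 (sub_ne_zero.2 hσ1)]
  have h1 := Real.add_one_lt_exp hk
  rw [Real.exp_neg, inv_eq_iff_eq_inv] at h
  rw [h] at h1
  simp at h1

/-- By Rolle's theorem, since the derivative of `x ↦ (1 + x) exp (-2 x) - 1 + x` vanishes only
at `0`. -/
lemma one_add_mul_exp_ne {x : ℝ} (hx : x ≠ 0) : (1 + x) * Real.exp (-2 * x) - 1 + x ≠ 0 := by
  intro h
  set f : ℝ → ℝ := fun y => (1 + y) * Real.exp (-2 * y) - 1 + y with hf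
  have hd : ∀ y, HasDerivAt f (1 - (1 + 2 * y) * Real.exp (-2 * y)) y := by
    intro y
    have h1 : HasDerivAt (fun y : ℝ => -2 * y) (-2) y := by
      simpa using (hasDerivAt_id y).const_mul (-2)
    refine (((((hasDerivAt_id y).const_add 1).mul h1.exp).sub_const 1).add
      (hasDerivAt_id y)).congr_deriv ?_
    simp only [id]
    ring
  have hne : ∀ y, y ≠ 0 → 1 - (1 + 2 * y) * Real.exp (-2 * y) ≠ 0 := by
    intro y hy h0
    have h1 := Real.add_one_lt_exp (x := 2 * y) (by simpa using hy)
    have h2 : Real.exp (2 * y) * Real.exp (-2 * y) = 1 := by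
      rw [← Real.exp_add]
      simp
    nlinarith [Real.exp_pos (-2 * y)]
  have h0 : f 0 = 0 := by simp [hf]
  have hc : Continuous f := continuous_iff_continuousAt.2 fun y => (hd y).continuousAt
  rcases lt_or_gt_of_ne hx with hx | hx
  · obtain ⟨c, hc, hc0⟩ := exists_hasDerivAt_eq_zero hx hc.continuousOn (h.trans h0.symm)
      fun y _ => hd y
    exact hne c hc.2.ne hc0
  · obtain ⟨c, hc, hc0⟩ := exists_hasDerivAt_eq_zero hx hc.continuousOn (h0.trans h.symm)
      fun y _ => hd y
    exact hne c hc.1.ne' hc0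

end NaiveGuidance

theorem mainTheorem1
    -- the target `N(μ, σ²)`, with unnormalised density `γ` and normalising constant `𝒵`
    (μ σ : ℝ) (hσ : 0 < σ) (γ : ℝ → ℝ) (𝒵 : ℝ) (h𝒵 : 0 < 𝒵)
    (hγ : ∀ x, gaussianPDFReal μ (σ ^ 2).toNNReal x = γ x / 𝒵)
    -- the schedule
    (β : ℝ → ℝ) (hβ_pos : ∀ t, 0 ≤ t → 0 < β t)
    (hβ_int : ∀ T : ℝ, 0 ≤ T → IntervalIntegrable β volume 0 T)
    (hβ_lim : Tendsto (fun T : ℝ => ∫ s in (0 : ℝ)..T, β s) atTop atTop)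
    -- for each horizon `T`, a solution `Z T` of the guided reverse diffusion on `[0, T]`
    (Ω : ℝ≥0 → Type*) [mΩ : ∀ T, MeasurableSpace (Ω T)]
    (P : ∀ T, Measure (Ω T)) [∀ T, IsProbabilityMeasure (P T)]
    (𝓕 : ∀ T, Filtration ℝ≥0 (mΩ T))
    (B Z : ∀ T, ℝ≥0 → Ω T → ℝ)
    (hZ0 : ∀ T : ℝ≥0, 0 < T → HasLaw (Z T 0) (gaussianReal 0 1) (P T))
    (hZ : ∀ T : ℝ≥0, 0 < T → NaiveGuidance.IsSDESolution
      (NaiveGuidance.drift β γ T) (NaiveGuidance.diffusionCoeff β T) T (𝓕 T) (B T) (P T) (Z T)) :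
    (∀ T : ℝ≥0, 0 < T → MemLp (Z T T) 2 (P T)) ∧
    (σ = 1 →
      Tendsto (fun T : ℝ≥0 => ∫ ω, Z T T ω ∂(P T)) atTop (𝓝 μ) ∧
      Tendsto (fun T : ℝ≥0 => variance (Z T T) (P T)) atTop (𝓝 1)) ∧
    (σ ≠ 1 →
      Tendsto (fun T : ℝ≥0 => ∫ ω, Z T T ω ∂(P T)) atTop
        (𝓝 (μ / (1 - σ ^ 2) * (1 - Real.exp (-(1 / σ ^ 2 - 1))))) ∧
      Tendsto (fun T : ℝ≥0 => variance (Z T T) (P T)) atTop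
        (𝓝 ((1 - Real.exp (-2 * (1 / σ ^ 2 - 1))) / (2 * (1 / σ ^ 2 - 1)))) ∧
      (μ ≠ 0 → ¬ Tendsto (fun T : ℝ≥0 => ∫ ω, Z T T ω ∂(P T)) atTop (𝓝 μ)) ∧
      ¬ Tendsto (fun T : ℝ≥0 => variance (Z T T) (P T)) atTop (𝓝 (σ ^ 2))) := by
  set k : ℝ := 1 / σ ^ 2 - 1 with hk
  have hσ2 : (0 : ℝ) < σ ^ 2 := by positivity
  have hk0 : σ ≠ 1 → k ≠ 0 := by
    intro hσ1 h
    have : σ ^ 2 = 1 := by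
      rw [hk, sub_eq_zero, div_eq_one_iff_eq hσ2.ne'] at h
      exact h.symm
    exact hσ1 ((pow_eq_one_iff_of_nonneg hσ.le two_ne_zero).1 this)
  -- All moments at horizon `T` are continuous functions of `h T = exp (-∫₀ᵀ β)`.
  have hmom := fun (T : ℝ≥0) (hT : 0 < T) => NaiveGuidance.guided_moments hσ h𝒵 hγ hβ_pos
    (hβ_int T T.coe_nonneg) (hZ0 T hT) (hZ T hT) hk rfl
  set h : ℝ≥0 → ℝ := fun T => Real.exp (-∫ s in (0 : ℝ)..T, β s) with hh
  have hh0 : Tendsto h atTop (𝓝 0) :=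
    Real.tendsto_exp_neg_atTop_nhds_zero.comp (hβ_lim.comp (NNReal.tendsto_coe_atTop.2 tendsto_id))
  have hlim : ∀ G : ℝ → ℝ, Continuous G → Tendsto (fun T => G (h T)) atTop (𝓝 (G 0)) :=
    fun G hG => (hG.tendsto 0).comp hh0
  refine ⟨fun T hT => (hmom T hT).1, fun hσ1 => ?_, fun hσ1 => ?_⟩
  · have hk1 : k = 0 := by simp [hk, hσ1]
    constructor
    · have hl := hlim (fun x => μ / σ ^ 2 * (1 - x * x)) (by fun_prop)
      have e : μ / σ ^ 2 * (1 - 0 * 0) = μ := by simp [hσ1]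
      rw [e] at hl
      refine hl.congr' ?_
      filter_upwards [eventually_gt_atTop 0] with T hT using ((hmom T hT).2.2 hk1).1.symm
    · refine tendsto_const_nhds.congr' ?_
      filter_upwards [eventually_gt_atTop 0] with T hT using ((hmom T hT).2.2 hk1).2.symm
  · have hk1 := hk0 hσ1
    have hσσ : 1 - σ ^ 2 = σ ^ 2 * k := by
      rw [hk]
      field_simp
    have hm : Tendsto (fun T : ℝ≥0 => ∫ ω, Z T T ω ∂(P T)) atTop
        (𝓝 (μ / (1 - σ ^ 2) * (1 - Real.exp (-k)))) := by
      have hl := hlim (fun x => μ / σ ^ 2 / k * (1 - Real.exp (-k + k * (x * x)))) (by fun_prop)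
      have e : μ / σ ^ 2 / k * (1 - Real.exp (-k + k * (0 * 0))) =
          μ / (1 - σ ^ 2) * (1 - Real.exp (-k)) := by
        rw [hσσ, div_div, mul_zero, mul_zero, add_zero]
      simp only [e] at hl
      refine hl.congr' ?_
      filter_upwards [eventually_gt_atTop 0] with T hT using ((hmom T hT).2.1 hk1).1.symm
    have hv : Tendsto (fun T : ℝ≥0 => variance (Z T T) (P T)) atTop
        (𝓝 ((1 - Real.exp (-2 * k)) / (2 * k))) := by
      have hl := hlim (fun x => (x * Real.exp (-k + k * (x * x))) ^ 2 +
          1 / (2 * k) * (1 - Real.exp (-k + k * (x * x)) ^ 2)) (by fun_prop)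
      have e : (0 * Real.exp (-k + k * (0 * 0))) ^ 2 +
          1 / (2 * k) * (1 - Real.exp (-k + k * (0 * 0)) ^ 2) =
          (1 - Real.exp (-2 * k)) / (2 * k) := by
        have : Real.exp (-2 * k) = Real.exp (-k) ^ 2 := by
          rw [← Real.exp_nat_mul]
          congr 1
          push_cast
          ring
        rw [this, mul_zero, mul_zero, add_zero]
        ring
      simp only [e] at hl
      refine hl.congr' ?_
      filter_upwards [eventually_gt_atTop 0] with T hT using ((hmom T hT).2.1 hk1).2.symm
    refine ⟨hm, hv, fun hμ hm' => ?_, fun hv' => ?_⟩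
    · have he := tendsto_nhds_unique hm hm'
      have h1 : 1 - σ ^ 2 ≠ 0 := by
        rw [hσσ]
        exact mul_ne_zero hσ2.ne' hk1
      refine NaiveGuidance.exp_neg_ne hσ hσ1 ?_
      rw [div_mul_eq_mul_div, div_eq_iff h1] at he
      have := mul_left_cancel₀ hμ he
      linarith
    · have he := tendsto_nhds_unique hv hv'
      refine NaiveGuidance.one_add_mul_exp_ne hk1 ?_
      have h2 : σ ^ 2 = 1 / (1 + k) := by simp [hk]
      have h3 : 1 + k ≠ 0 := by simp [hk, hσ.ne']
      rw [h2, div_eq_div_iff (mul_ne_zero two_ne_zero hk1) h3] at he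
      linarith
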